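/- Notation. An online algorithm $M$ with data universe $\mathcal X$, state space $\mathcal S$ and output space $\mathcal O$ consists of independently randomized internal algorithms $M_1:\mathcal X\to\mathcal S$ and $M_i:\mathcal X\times\mathcal S\to\mathcal S$ ($i\ge 2$), and a randomized output algorithm $M_{\mathcal O}:\mathcal S\to\mathcal O$. On a stream $\vec x=(x_1,\dots,x_n)$ it computes the states $S_1=M_1(x_1)$ and $S_i=M_i(x_i,S_{i-1})$ for $2\le i\le n$, and outputs $M(\vec x)=M_{\mathcal O}(S_n)$. It is $(\varepsilon,\delta)$-pan-private on streams of length $n$ if for all $\vec x,\vec x'\in\mathcal X^n$ that differ in at most one element, every time $1\le t\le n$ and every (measurable) $T\subseteq\mathcal S\times\mathcal O$, $$\Pr[(S_t(\vec x),M(\vec x))\in T]\le e^{\varepsilon}\,\Pr[(S_t(\vec x'),M(\vec x'))\in T]+\delta .$$ For $\alpha\in(0,1/2)$ and an integer $d\ge 2$, $M$ solves $(\alpha,d)$-selection with sample complexity $n$ if, for every probability distribution $\mathbf P$ on $\{\pm1\}^d$, when run on $n$ independent samples from $\mathbf P$ it outputs, with probability at least $99/100$ over the samples and the randomness of $M$,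 a coordinate $J\in\{1,\dots,d\}$ with $\mathbb E_{X\sim\mathbf P}[X_J]\ge\max_j\mathbb E_{X\sim\mathbf P}[X_j]-\alpha$. Theorem. There are absolute constants $c,C>0$ such that the following holds for every integer $d\ge2$, every $\alpha\in(0,1/2)$, every $\varepsilon>0$, every $\delta\in[0,1]$ and every $n\ge 1$. Let $M=(M_1,\dots,M_n,M_{\mathcal O})$ be an online algorithm, with an arbitrary measurable state space, that is $(\varepsilon,\delta)$-pan-private on streams of length $n$ and solves $(\alpha,d)$-selection with sample complexity $n$. If $$\delta\log\frac{d}{\delta}\le c\,\frac{\alpha^2\varepsilon^2}{d}$$ (the left-hand side being $0$ for $\delta=0$), then $$n\ge C\,\frac{\sqrt d}{\alpha\varepsilon}.$$ -/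

import Mathlib

open MeasureTheory ProbabilityTheory

/-- A randomized online algorithm with data universe `X`, set of internal states `S` and set of
outputs `O`. The first internal algorithm `M₁` maps the first element of the stream to a (random)
state; for `i ≥ 2`, the internal algorithm `Mᵢ`, which is `update i`, maps the `i`-th element of the
stream and the previous state to a new state; `output` maps the final state to the output. The
values `update 0` and `update 1` play no role. Each algorithm uses fresh randomness, so it is a
Markov kernel. -/
structure OnlineAlgorithm (X S O : Type*) [MeasurableSpace X] [MeasurableSpace S]
    [MeasurableSpace O] where
  first : Kernel X S
  update : ℕ → Kernel (X × S) S
  output : Kernel S O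
  isMarkovKernel_first : IsMarkovKernel first
  isMarkovKernel_update : ∀ i, IsMarkovKernel (update i)
  isMarkovKernel_output : IsMarkovKernel output

namespace OnlineAlgorithm

attribute [instance] isMarkovKernel_first isMarkovKernel_update isMarkovKernel_output

variable {X S O : Type*} [MeasurableSpace X] [MeasurableSpace S] [MeasurableSpace O]

/-- The law of the state reached from the state `s` after `k` elements, once the further elements
in the list have been processed by `M_{k+1}, M_{k+2}, …`. -/
noncomputable def run (M : OnlineAlgorithm X S O) : ℕ → List X → Kernel S S
  | _, [] => Kernel.id
  | k, a :: l => M.run (k + 1) l ∘ₖ (M.update (k + 1)).sectR a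

instance isMarkovKernel_run (M : OnlineAlgorithm X S O) (k : ℕ) (l : List X) :
    IsMarkovKernel (M.run k l) := by
  induction l generalizing k with
  | nil => unfold run; infer_instance
  | cons a l ih => unfold run; have := ih (k + 1); infer_instance

/-- The law of the internal state after processing a (nonempty) stream. -/
noncomputable def stateLaw (M : OnlineAlgorithm X S O) : List X → Measure S
  | [] => 0
  | a :: l => (M.first a).bind (M.run 1 l)

theorem isProbabilityMeasure_stateLaw (M : OnlineAlgorithm X S O) {l : List X} (h : l ≠ []) :
    IsProbabilityMeasure (M.stateLaw l) := by
  cases l with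
  | nil => simp at h
  | cons a l => unfold stateLaw; infer_instance

/-- The law of the output on a (nonempty) stream. -/
noncomputable def outputLaw (M : OnlineAlgorithm X S O) (x : List X) : Measure O :=
  (M.stateLaw x).bind M.output

/-- The joint law of the internal state after the first `t` elements of the stream `x` and of the
output at the end of the same execution on `x`. -/
noncomputable def viewLaw (M : OnlineAlgorithm X S O) (t : ℕ) (x : List X) : Measure (S × O) :=
  (M.stateLaw (x.take t)) ⊗ₘ (M.output ∘ₖ M.run t (x.drop t))

/-- `(ε, δ)`-pan-privacy on streams of length `n`: the joint law of the state at one time `t` and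
of the output is `(ε, δ)`-indistinguishable on streams that differ in at most one element. -/
def IsPanPrivate (M : OnlineAlgorithm X S O) (n : ℕ) (ε δ : ℝ) : Prop :=
  ∀ x x' : Fin n → X, (∃ i, ∀ j, j ≠ i → x j = x' j) →
    ∀ t : ℕ, 1 ≤ t → t ≤ n → ∀ T : Set (S × O), MeasurableSet T →
      M.viewLaw t (List.ofFn x) T ≤
        ENNReal.ofReal (Real.exp ε) * M.viewLaw t (List.ofFn x') T + ENNReal.ofReal δ

end OnlineAlgorithm

/-- Every subset of `{±1}` is measurable. -/
instance discreteMeasurableSpace_intUnits : DiscreteMeasurableSpace ℤˣ where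
  forall_measurableSet s :=
    ⟨Units.val '' s, MeasurableSet.of_discrete, Set.preimage_image_eq s Units.val_injective⟩

/-- The data universe `{±1}ᵈ`; the group of units of `ℤ` is `{±1}`. -/
abbrev SignCube (d : ℕ) : Type := Fin d → ℤˣ

/-- The mean of the `j`-th coordinate under the distribution `P`. -/
noncomputable def coordMean {d : ℕ} (P : Measure (SignCube d)) (j : Fin d) : ℝ :=
  ∫ x, ((x j : ℤ) : ℝ) ∂P

/-- A randomized algorithm, given by the law `A x` of the selected coordinate on the dataset `x`,
solves `(α, d)`-selection with `n` samples: for every distribution `P` on `{±1}ᵈ`, if `x` consists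
of `n` independent samples from `P`, then with probability at least `99/100` over `x` and the
randomness of the algorithm, the selected coordinate has mean within `α` of the largest one. -/
def SolvesSelection {d n : ℕ} (A : (Fin n → SignCube d) → Measure (Fin d)) (α : ℝ) : Prop :=
  ∀ P : Measure (SignCube d), IsProbabilityMeasure P →
    99 / 100 ≤ ∫⁻ x, A x {J | ∀ j, coordMean P j - α ≤ coordMean P J} ∂(Measure.pi fun _ => P)

/-! For each coordinate `v`, let P_v be the distribution on the cube whose density relative to the
uniform one is 1 + 2α x_v. On P_v only `v` is an acceptable answer, so summing the probability of
outputting `v` over all `v` gives at least 0.99 d; on uniform data that sum is 1. The gap is crossed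
by n hybrids that turn one sample at a time from uniform to tilted, each with a uniform prefix and a
tilted suffix. The prefix law does not depend on `v`, so one hybrid step, summed over `v`, equals 2α
E_a ∫ Σ_v a_v g_v dR_a. Here R_a is the law of the state just after reading a, and g_v(s) ∈ [0,1] is
the chance of ending at `v` from state s. Privacy makes the R_a pairwise close. Against one fixed
law the signed sum averages to 0 over a and has typical size √d, so a step gains only O(α(ε√d + δd))
(`cubeMean_integral_signedSum_le`). Hence d ≲ nα(ε√d + δd), and the condition on δ absorbs the last
term. -/

/-! ### Expectations over i.i.d. streams. -/

section ListExpectation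

variable {X : Type*} [Fintype X]

/-- The expectation of `f` over streams of `n` independent elements with weights `w`. -/
noncomputable def streamMean (w : X → ℝ) (n : ℕ) (f : List X → ℝ) : ℝ :=
  ∑ x : Fin n → X, (∏ i, w (x i)) * f (List.ofFn x)

theorem streamMean_zero (w : X → ℝ) (f : List X → ℝ) : streamMean w 0 f = f [] := by
  simp [streamMean]

theorem streamMean_cons (w : X → ℝ) (n : ℕ) (f : List X → ℝ) :
    streamMean w (n + 1) f = ∑ a, w a * streamMean w n (fun l => f (a :: l)) := by
  unfold streamMean
  rw [← (Fin.consEquiv fun _ => X).sum_comp, Fintype.sum_prod_type]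
  simp [Fin.consEquiv, Fin.prod_univ_succ, Finset.mul_sum, mul_assoc]

/-- A hybrid step exposes the sample at the boundary: the last one of the uniform prefix, or by
`streamMean_cons` the first one of the tilted suffix. -/
theorem streamMean_concat (w : X → ℝ) (n : ℕ) (f : List X → ℝ) :
    streamMean w (n + 1) f = streamMean w n (fun l => ∑ a, w a * f (l ++ [a])) := by
  induction n generalizing f with
  | zero => simp [streamMean_cons, streamMean_zero]
  | succ n ih =>
    rw [streamMean_cons, streamMean_cons]
    exact Finset.sum_congr rfl fun a _ => by rw [ih]; simp

theorem streamMean_sum {ι : Type*} (s : Finset ι) (w : X → ℝ) (n : ℕ) (f : ι → List X → ℝ) :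
    streamMean w n (fun l => ∑ i ∈ s, f i l) = ∑ i ∈ s, streamMean w n (f i) := by
  unfold streamMean
  rw [Finset.sum_comm]
  simp [Finset.mul_sum]

theorem streamMean_sub (w : X → ℝ) (n : ℕ) (f g : List X → ℝ) :
    streamMean w n (fun l => f l - g l) = streamMean w n f - streamMean w n g := by
  simp [streamMean, mul_sub, Finset.sum_sub_distrib]

theorem streamMean_const {w : X → ℝ} (hw : ∑ a, w a = 1) (n : ℕ) (c : ℝ) :
    streamMean w n (fun _ => c) = c := by
  induction n with
  | zero => simp [streamMean_zero]
  | succ n ih => simp [streamMean_cons, ih, ← Finset.sum_mul, hw]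

theorem streamMean_mono {w : X → ℝ} (hw : ∀ a, 0 ≤ w a) {n : ℕ} {f g : List X → ℝ}
    (h : ∀ l, l.length = n → f l ≤ g l) : streamMean w n f ≤ streamMean w n g :=
  Finset.sum_le_sum fun x _ => mul_le_mul_of_nonneg_left (h _ (by simp))
    (Finset.prod_nonneg fun _ _ => hw _)

theorem integral_streamMean {S : Type*} [MeasurableSpace S] (μ : Measure S) (w : X → ℝ) (n : ℕ)
    (h : List X → S → ℝ) (hi : ∀ l, Integrable (h l) μ) :
    ∫ s, streamMean w n (fun l => h l s) ∂μ = streamMean w n (fun l => ∫ s, h l s ∂μ) := by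
  unfold streamMean
  rw [integral_finsetSum _ fun x _ => (hi _).const_mul _]
  simp [integral_const_mul]

end ListExpectation

/-! ### Indistinguishability for bounded test functions. -/

section Indistinguishable

variable {S : Type*} [MeasurableSpace S]

/-- One-sided `(ε, δ)`-indistinguishability of two measures. -/
def Indist (ε δ : ℝ) (μ ν : Measure S) : Prop :=
  ∀ T, MeasurableSet T → μ T ≤ ENNReal.ofReal (Real.exp ε) * ν T + ENNReal.ofReal δ

/-- Layer cake: integrate the inequality for the superlevel sets {t ≤ φ} over t in (0, B]; the
additive δ accumulates to δB. -/
theorem Indist.integral_le {ε δ : ℝ} (hδ : 0 ≤ δ) {μ ν : Measure S} [IsProbabilityMeasure μ]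
    [IsProbabilityMeasure ν] (h : Indist ε δ μ ν) {φ : S → ℝ} (hφ : Measurable φ)
    (h0 : ∀ s, 0 ≤ φ s) {B : ℝ} (hB : ∀ s, φ s ≤ B) :
    ∫ s, φ s ∂μ ≤ Real.exp ε * ∫ s, φ s ∂ν + δ * B := by
  have hint : ∀ (ρ : Measure S) [IsProbabilityMeasure ρ], Integrable φ ρ := fun ρ _ =>
    Integrable.of_bound hφ.aestronglyMeasurable B
      (Filter.Eventually.of_forall fun s => by rw [Real.norm_of_nonneg (h0 s)]; exact hB s)
  have hB0 : 0 ≤ B := by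
    obtain ⟨s⟩ := nonempty_of_isProbabilityMeasure μ
    exact (h0 s).trans (hB s)
  have hlayer : ∀ (ρ : Measure S) [IsProbabilityMeasure ρ],
      ∫ s, φ s ∂ρ = ∫ t in Set.Ioc 0 B, ρ.real {s | t ≤ φ s} := fun ρ _ =>
    (hint ρ).integral_eq_integral_Ioc_meas_le (Filter.Eventually.of_forall h0)
      (Filter.Eventually.of_forall hB)
  have hmeas : ∀ (ρ : Measure S) [IsProbabilityMeasure ρ],
      IntegrableOn (fun t => ρ.real {s | t ≤ φ s}) (Set.Ioc 0 B) := fun ρ _ => by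
    have hanti : Antitone fun t => ρ.real {s | t ≤ φ s} := fun a b hab =>
      measureReal_mono fun s hs => hab.trans hs
    exact (hanti.antitoneOn _).integrableOn_isCompact (μ := volume) isCompact_Icc
      |>.mono_set Set.Ioc_subset_Icc_self
  have hreal : ∀ T, MeasurableSet T → μ.real T ≤ Real.exp ε * ν.real T + δ := fun T hT => by
    have := ENNReal.toReal_mono (by finiteness) (h T hT)
    rw [ENNReal.toReal_add (by finiteness) (by finiteness), ENNReal.toReal_mul,
      ENNReal.toReal_ofReal (Real.exp_pos _).le, ENNReal.toReal_ofReal hδ] at this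
    exact this
  rw [hlayer μ, hlayer ν, ← integral_const_mul]
  have hc : δ * B = ∫ _ in Set.Ioc 0 B, δ := by simp [hB0, mul_comm]
  rw [hc, ← integral_add ((hmeas ν).const_mul _) (by simp)]
  exact integral_mono (hmeas μ) (((hmeas ν).const_mul _).add (by simp))
    fun t => hreal _ (measurableSet_le measurable_const hφ)

end Indistinguishable

/-! ### Fourier and moment estimates on the cube. -/

section Cube

variable {d : ℕ}

/-- The real value of the `j`-th coordinate. -/
def coordVal (j : Fin d) (x : SignCube d) : ℝ := ((x j : ℤ) : ℝ)

theorem coordVal_sq (j : Fin d) (x : SignCube d) : coordVal j x * coordVal j x = 1 := by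
  rcases Int.units_eq_one_or (x j) with h | h <;> simp [coordVal, h]

theorem abs_coordVal (j : Fin d) (x : SignCube d) : |coordVal j x| = 1 := by
  rcases Int.units_eq_one_or (x j) with h | h <;> simp [coordVal, h]

theorem card_signCube : (Fintype.card (SignCube d) : ℝ) = 2 ^ d := by
  simp [SignCube]

theorem sum_uniformWeight (d : ℕ) : ∑ _x : SignCube d, (2 ^ d : ℝ)⁻¹ = 1 := by
  rw [Finset.sum_const, Finset.card_univ, nsmul_eq_mul, card_signCube,
    mul_inv_cancel₀ (by positivity)]

/-- The average of a function over the cube. -/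
noncomputable def cubeMean (f : SignCube d → ℝ) : ℝ := ∑ x, (2 ^ d : ℝ)⁻¹ * f x

theorem cubeMean_const (c : ℝ) : cubeMean (fun _ : SignCube d => c) = c := by
  rw [cubeMean, ← Finset.sum_mul, sum_uniformWeight, one_mul]

theorem cubeMean_mono {f g : SignCube d → ℝ} (h : ∀ x, f x ≤ g x) : cubeMean f ≤ cubeMean g :=
  Finset.sum_le_sum fun x _ => mul_le_mul_of_nonneg_left (h x) (by positivity)

theorem cubeMean_add (f g : SignCube d → ℝ) :
    cubeMean (fun x => f x + g x) = cubeMean f + cubeMean g := by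
  simp [cubeMean, mul_add, Finset.sum_add_distrib]

theorem cubeMean_const_mul (c : ℝ) (f : SignCube d → ℝ) :
    cubeMean (fun x => c * f x) = c * cubeMean f := by
  simp [cubeMean, Finset.mul_sum, mul_left_comm]

theorem cubeMean_sum {ι : Type*} (s : Finset ι) (f : ι → SignCube d → ℝ) :
    cubeMean (fun x => ∑ i ∈ s, f i x) = ∑ i ∈ s, cubeMean (f i) := by
  unfold cubeMean
  rw [Finset.sum_comm]
  simp [Finset.mul_sum]

theorem integral_cubeMean {S : Type*} [MeasurableSpace S] (μ : Measure S)
    {f : SignCube d → S → ℝ} (hf : ∀ x, Integrable (f x) μ) :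
    ∫ s, cubeMean (fun x => f x s) ∂μ = cubeMean (fun x => ∫ s, f x s ∂μ) := by
  unfold cubeMean
  rw [integral_finsetSum _ fun x _ => (hf x).const_mul _]
  simp [integral_const_mul]

/-- Flipping the sign of coordinate `j` is a bijection of the cube. -/
theorem cubeMean_eq_zero_of_flip (j : Fin d) {f : SignCube d → ℝ}
    (h : ∀ x, f (Pi.mulSingle j (-1) * x) = -f x) : cubeMean f = 0 := by
  have h1 : cubeMean f = -cubeMean f := by
    unfold cubeMean
    rw [← Finset.sum_neg_distrib]
    refine Fintype.sum_equiv (Equiv.mulLeft (Pi.mulSingle j (-1))) _ _ fun x => ?_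
    simp [h]
  linarith

theorem coordVal_flip_self (j : Fin d) (x : SignCube d) :
    coordVal j (Pi.mulSingle j (-1) * x) = -coordVal j x := by
  simp [coordVal]

theorem coordVal_flip_of_ne {i j : Fin d} (h : i ≠ j) (x : SignCube d) :
    coordVal i (Pi.mulSingle j (-1) * x) = coordVal i x := by
  simp [coordVal, h]

theorem cubeMean_coordVal (j : Fin d) : cubeMean (coordVal j) = 0 :=
  cubeMean_eq_zero_of_flip j (coordVal_flip_self j)

theorem cubeMean_coordVal_mul (i j : Fin d) :
    cubeMean (fun x => coordVal i x * coordVal j x) = if i = j then 1 else 0 := by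
  split_ifs with h
  · subst h; simp [coordVal_sq, cubeMean_const]
  · exact cubeMean_eq_zero_of_flip j fun x => by
      rw [coordVal_flip_self, coordVal_flip_of_ne h]; ring

/-- The signed sum of the coefficients `h`. -/
def signedSum (h : Fin d → ℝ) (x : SignCube d) : ℝ := ∑ j, h j * coordVal j x

theorem cubeMean_signedSum (h : Fin d → ℝ) : cubeMean (signedSum h) = 0 := by
  change cubeMean (fun x => ∑ j, h j * coordVal j x) = 0
  rw [cubeMean_sum]
  refine Finset.sum_eq_zero fun j _ => ?_
  rw [cubeMean_const_mul]
  exact mul_eq_zero_of_right _ (cubeMean_coordVal j)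

theorem cubeMean_signedSum_sq (h : Fin d → ℝ) :
    cubeMean (fun x => signedSum h x ^ 2) = ∑ j, h j ^ 2 := by
  have : ∀ x, signedSum h x ^ 2 = ∑ i, ∑ j, h i * h j * (coordVal i x * coordVal j x) := fun x => by
    rw [sq, signedSum, Finset.sum_mul_sum]
    exact Finset.sum_congr rfl fun i _ => Finset.sum_congr rfl fun j _ => by ring
  simp_rw [this, cubeMean_sum, cubeMean_const_mul, cubeMean_coordVal_mul]
  simp [sq]

theorem abs_signedSum_le {h : Fin d → ℝ} (h0 : ∀ j, 0 ≤ h j) (h1 : ∀ j, h j ≤ 1)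
    (x : SignCube d) : |signedSum h x| ≤ d := by
  calc |signedSum h x| ≤ ∑ j, |h j * coordVal j x| := Finset.abs_sum_le_sum_abs _ _
    _ ≤ ∑ _j : Fin d, (1 : ℝ) := Finset.sum_le_sum fun j _ => by
        rw [abs_mul, abs_coordVal, abs_of_nonneg (h0 j), mul_one]; exact h1 j
    _ = d := by simp

/-- AM-GM in the form |H| ≤ H²/(2√d) + √d/2 reduces this to the second moment, which is at most d.
-/
theorem cubeMean_abs_signedSum_le (hd : 0 < d) {h : Fin d → ℝ} (h0 : ∀ j, 0 ≤ h j)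
    (h1 : ∀ j, h j ≤ 1) : cubeMean (fun x => |signedSum h x|) ≤ Real.sqrt d := by
  have hs : 0 < Real.sqrt d := Real.sqrt_pos.2 (by exact_mod_cast hd)
  have hss : Real.sqrt d * Real.sqrt d = d := Real.mul_self_sqrt (by positivity)
  have hpt : ∀ x, |signedSum h x| ≤
      (2 * Real.sqrt d)⁻¹ * signedSum h x ^ 2 + Real.sqrt d / 2 := fun x => by
    have := sq_nonneg (|signedSum h x| - Real.sqrt d)
    rw [sub_sq, sq_abs] at this
    rw [← sub_nonneg]
    have e : (2 * Real.sqrt d)⁻¹ * signedSum h x ^ 2 + Real.sqrt d / 2 - |signedSum h x| =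
      (2 * Real.sqrt d)⁻¹ * (signedSum h x ^ 2 - 2 * |signedSum h x| * Real.sqrt d +
        Real.sqrt d ^ 2) := by field_simp; ring
    rw [e]; positivity
  refine (cubeMean_mono hpt).trans ?_
  rw [cubeMean_add, cubeMean_const_mul, cubeMean_const, cubeMean_signedSum_sq]
  have : ∑ j, h j ^ 2 ≤ (d : ℝ) := by
    calc ∑ j, h j ^ 2 ≤ ∑ _j : Fin d, (1 : ℝ) :=
          Finset.sum_le_sum fun j _ => pow_le_one₀ (h0 j) (h1 j)
      _ = d := by simp
  calc (2 * Real.sqrt d)⁻¹ * ∑ j, h j ^ 2 + Real.sqrt d / 2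
      ≤ (2 * Real.sqrt d)⁻¹ * d + Real.sqrt d / 2 := by gcongr
    _ = Real.sqrt d := by nth_rewrite 2 [← hss]; field_simp; norm_num

theorem cubeMean_exp_signedSum (h : Fin d → ℝ) :
    cubeMean (fun x => Real.exp (signedSum h x)) = ∏ j, Real.cosh (h j) := by
  have h1 : ∀ j, Real.cosh (h j) = ∑ b : ℤˣ, (2 : ℝ)⁻¹ * Real.exp (h j * ((b : ℤ) : ℝ)) := fun j => by
    have : (Finset.univ : Finset ℤˣ) = {1, -1} := rfl
    rw [this, Finset.sum_pair (by decide), Real.cosh_eq]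
    simp; ring
  simp_rw [h1]
  rw [Finset.prod_univ_sum, Fintype.piFinset_univ]
  simp [cubeMean, signedSum, Real.exp_sum, Finset.prod_mul_distrib, coordVal]

/-- Hoeffding's bound: the moment factors over coordinates, and cosh x ≤ exp(x²/2). -/
theorem cubeMean_exp_signedSum_le (hd : 0 < d) {h : Fin d → ℝ} (h0 : ∀ j, 0 ≤ h j)
    (h1 : ∀ j, h j ≤ 1) :
    cubeMean (fun x => Real.exp (signedSum h x / Real.sqrt d)) ≤ Real.exp (1 / 2) := by
  have e : ∀ x, signedSum h x / Real.sqrt d = signedSum (fun j => h j / Real.sqrt d) x := fun x => by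
    simp only [signedSum, Finset.sum_div]
    exact Finset.sum_congr rfl fun j _ => by ring
  simp_rw [e, cubeMean_exp_signedSum]
  have hd' : (0 : ℝ) < d := by exact_mod_cast hd
  calc ∏ j, Real.cosh (h j / Real.sqrt d) ≤ ∏ _j : Fin d, Real.exp (1 / (2 * d)) := by
        refine Finset.prod_le_prod (fun j _ => (Real.cosh_pos _).le) fun j _ => ?_
        refine (Real.cosh_le_exp_half_sq _).trans (Real.exp_le_exp.2 ?_)
        rw [div_pow, Real.sq_sqrt hd'.le, div_div, mul_comm (d : ℝ) 2]
        gcongr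
        exact pow_le_one₀ (h0 j) (h1 j)
    _ = Real.exp (1 / 2) := by
        rw [Finset.prod_const, Finset.card_univ, Fintype.card_fin, ← Real.exp_nat_mul]
        congr 1; field_simp

end Cube

/-! ### Correlation bound for a private randomizer. -/

section CubeIndist

variable {d : ℕ} {S : Type*} [MeasurableSpace S]

/-- A randomizer whose outputs on the points of the cube are pairwise `(ε, δ)`-indistinguishable
has small correlation with signed sums of `[0, 1]`-valued tests. -/
theorem cubeMean_integral_signedSum_le (hd : 0 < d) {ε δ : ℝ} (hε : 0 < ε) (hδ : 0 ≤ δ)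
    (R : SignCube d → Measure S) [∀ a, IsProbabilityMeasure (R a)]
    (hR : ∀ a b, Indist ε δ (R a) (R b)) (h : Fin d → S → ℝ) (hm : ∀ j, Measurable (h j))
    (h0 : ∀ j s, 0 ≤ h j s) (h1 : ∀ j s, h j s ≤ 1) :
    cubeMean (fun a => ∫ s, signedSum (fun j => h j s) a ∂(R a)) ≤
      2 * ε * Real.sqrt d + 2 * δ * d := by
  have hd' : (0 : ℝ) < d := by exact_mod_cast hd
  have hs : 0 < Real.sqrt d := Real.sqrt_pos.2 hd'
  have hss : Real.sqrt d * Real.sqrt d = d := Real.mul_self_sqrt hd'.le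
  set H : SignCube d → S → ℝ := fun a s => signedSum (fun j => h j s) a with hH
  have hHm : ∀ a, Measurable (H a) := fun a => by
    simp only [hH, signedSum]; fun_prop
  have hHb : ∀ a s, |H a s| ≤ d := fun a s => abs_signedSum_le (fun j => h0 j s) (fun j => h1 j s) a
  have hHi : ∀ (ρ : Measure S) [IsProbabilityMeasure ρ] a, Integrable (H a) ρ := fun ρ _ a =>
    Integrable.of_bound (hHm a).aestronglyMeasurable d (Filter.Eventually.of_forall (hHb a))
  -- Any of the laws serves as common reference; `1` is the all-ones point.
  set Q : Measure S := R 1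
  rcases le_total ε 1 with hε1 | hε1
  -- For ε ≤ 1, move from `R a` to `Q` separately on the positive and negative parts of H. The error
  -- is proportional to E|H| ≤ √d, and the main term averages to 0 over a.
  · have hpt : ∀ a, ∫ s, H a s ∂(R a) ≤
        ∫ s, H a s ∂Q + (Real.exp ε - 1) * ∫ s, |H a s| ∂Q + 2 * δ * d := fun a => by
      set p : S → ℝ := fun s => max (H a s) 0 with hp
      set q : S → ℝ := fun s => max (-H a s) 0 with hq
      have hpm : Measurable p := (hHm a).max measurable_const
      have hqm : Measurable q := (hHm a).neg.max measurable_const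
      have hp0 : ∀ s, 0 ≤ p s := fun s => le_max_right _ _
      have hq0 : ∀ s, 0 ≤ q s := fun s => le_max_right _ _
      have hpd : ∀ s, p s ≤ d := fun s => max_le ((le_abs_self _).trans (hHb a s)) hd'.le
      have hqd : ∀ s, q s ≤ d := fun s => max_le ((neg_le_abs _).trans (hHb a s)) hd'.le
      have hpi : ∀ (ρ : Measure S) [IsProbabilityMeasure ρ], Integrable p ρ := fun ρ _ =>
        (hHi ρ a).pos_part
      have hqi : ∀ (ρ : Measure S) [IsProbabilityMeasure ρ], Integrable q ρ := fun ρ _ =>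
        (hHi ρ a).neg_part
      have e1 : ∀ s, H a s = p s - q s := fun s => by
        simp only [hp, hq]
        rcases le_total (H a s) 0 with h | h <;> simp [h]
      have e2 : ∀ s, |H a s| = p s + q s := fun s => by
        simp only [hp, hq]
        rcases le_total (H a s) 0 with h | h <;> simp [h, abs_of_nonpos, abs_of_nonneg]
      have i1 := (hR a 1).integral_le hδ hpm hp0 hpd
      have i2 := (hR 1 a).integral_le hδ hqm hq0 hqd
      simp_rw [e2, e1]
      rw [integral_sub (hpi _) (hqi _), integral_sub (hpi _) (hqi _), integral_add (hpi _) (hqi _)]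
      have hqa : 0 ≤ ∫ s, q s ∂(R a) := integral_nonneg hq0
      have hqQ : 0 ≤ ∫ s, q s ∂Q := integral_nonneg hq0
      have hex : 1 ≤ Real.exp ε := Real.one_le_exp hε.le
      have hdd : 0 ≤ δ * d := by positivity
      change ∫ s, p s ∂(R a) ≤ Real.exp ε * ∫ s, p s ∂Q + δ * d at i1
      change ∫ s, q s ∂Q ≤ Real.exp ε * ∫ s, q s ∂(R a) + δ * d at i2
      -- Replaces exp(-ε) by its lower bound 2 - exp ε, so that both parts carry the same error
      -- factor exp ε - 1.
      have i3 : (2 - Real.exp ε) * ∫ s, q s ∂Q ≤ ∫ s, q s ∂(R a) + δ * d := by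
        by_cases hc : 0 ≤ 2 - Real.exp ε
        · calc (2 - Real.exp ε) * ∫ s, q s ∂Q
              ≤ (2 - Real.exp ε) * (Real.exp ε * ∫ s, q s ∂(R a) + δ * d) := by gcongr
            _ ≤ ∫ s, q s ∂(R a) + δ * d := by
              nlinarith [mul_nonneg (sq_nonneg (Real.exp ε - 1)) hqa,
                mul_nonneg (sub_nonneg.2 hex) hdd]
        · nlinarith [mul_nonneg (not_le.1 hc |>.le |> neg_nonneg.2) hqQ]
      linarith
    refine (cubeMean_mono hpt).trans ?_
    rw [cubeMean_add, cubeMean_add, cubeMean_const_mul, cubeMean_const, ← integral_cubeMean Q (hHi Q),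
      ← integral_cubeMean Q fun a => (hHi Q a).abs]
    have z : ∀ s, cubeMean (fun x => H x s) = 0 := fun s => cubeMean_signedSum _
    simp_rw [z]
    have hle : ∫ s, cubeMean (fun x => |H x s|) ∂Q ≤ Real.sqrt d := by
      calc ∫ s, cubeMean (fun x => |H x s|) ∂Q ≤ ∫ _s, Real.sqrt d ∂Q := by
            refine integral_mono ?_ (integrable_const _) fun s =>
              cubeMean_abs_signedSum_le hd (fun j => h0 j s) (fun j => h1 j s)
            exact integrable_finsetSum _ fun x _ => ((hHi Q x).abs).const_mul _
        _ = Real.sqrt d := by simp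
    have hexp : Real.exp ε - 1 ≤ 2 * ε := by
      have := Real.abs_exp_sub_one_le (x := ε) (by rwa [abs_of_pos hε])
      rw [abs_of_pos hε] at this
      exact (le_abs_self _).trans this
    have := mul_le_mul hexp hle (integral_nonneg fun s =>
      Finset.sum_nonneg fun x _ => by positivity) (by positivity)
    simp only [integral_zero]
    linarith
  -- For ε ≥ 1 the factor exp ε - 1 is too large, so only the excess of H/√d over K - 1 is moved to
  -- `Q`. This K makes exp(-K) times the moment bound exp(1/2) equal exp(-ε), which cancels the
  -- privacy factor.
  · set K : ℝ := ε + 1 / 2 with hK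
    set φ : SignCube d → S → ℝ := fun a s => max (H a s / Real.sqrt d - (K - 1)) 0 with hφ
    have hφm : ∀ a, Measurable (φ a) := fun a =>
      (((hHm a).div_const _).sub_const _).max measurable_const
    have hφ0 : ∀ a s, 0 ≤ φ a s := fun a s => le_max_right _ _
    have hφd : ∀ a s, φ a s ≤ Real.sqrt d := fun a s => by
      refine max_le ?_ hs.le
      have : H a s / Real.sqrt d ≤ Real.sqrt d := by
        rw [div_le_iff₀ hs, hss]; exact (le_abs_self _).trans (hHb a s)
      linarith
    have hφi : ∀ (ρ : Measure S) [IsProbabilityMeasure ρ] a, Integrable (φ a) ρ := fun ρ _ a =>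
      Integrable.of_bound (hφm a).aestronglyMeasurable (Real.sqrt d)
        (Filter.Eventually.of_forall fun s => by
          rw [Real.norm_of_nonneg (hφ0 a s)]; exact hφd a s)
    have hφe : ∀ a s, φ a s ≤ Real.exp (-K) * Real.exp (H a s / Real.sqrt d) := fun a s => by
      rw [← Real.exp_add]
      refine max_le ?_ (Real.exp_pos _).le
      have := Real.add_one_le_exp (-K + H a s / Real.sqrt d)
      linarith
    have hpt : ∀ a, ∫ s, H a s ∂(R a) ≤
        Real.sqrt d * ((K - 1) + (Real.exp ε * ∫ s, φ a s ∂Q + δ * Real.sqrt d)) := fun a => by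
      have i1 := (hR a 1).integral_le hδ (hφm a) (hφ0 a) (hφd a)
      calc ∫ s, H a s ∂(R a) ≤ ∫ s, Real.sqrt d * ((K - 1) + φ a s) ∂(R a) := by
            refine integral_mono (hHi _ a) (((integrable_const _).add (hφi _ a)).const_mul _)
              fun s => ?_
            have : H a s / Real.sqrt d - (K - 1) ≤ φ a s := le_max_left _ _
            have h3 : H a s / Real.sqrt d ≤ (K - 1) + φ a s := by linarith
            rwa [div_le_iff₀' hs] at h3
        _ = Real.sqrt d * ((K - 1) + ∫ s, φ a s ∂(R a)) := by
            rw [integral_const_mul, integral_add (integrable_const _) (hφi _ a)]; simp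
        _ ≤ _ := by gcongr
    refine (cubeMean_mono hpt).trans ?_
    rw [cubeMean_const_mul, cubeMean_add, cubeMean_add, cubeMean_const_mul, cubeMean_const,
      cubeMean_const, ← integral_cubeMean Q (hφi Q)]
    have hle : ∫ s, cubeMean (fun x => φ x s) ∂Q ≤ Real.exp (-ε) := by
      calc ∫ s, cubeMean (fun x => φ x s) ∂Q ≤ ∫ _s, Real.exp (-ε) ∂Q := by
            refine integral_mono ?_ (integrable_const _) fun s => ?_
            · exact integrable_finsetSum _ fun x _ => (hφi Q x).const_mul _
            refine (cubeMean_mono fun a => hφe a s).trans ?_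
            rw [cubeMean_const_mul]
            calc _ ≤ Real.exp (-K) * Real.exp (1 / 2) := by
                  gcongr
                  exact cubeMean_exp_signedSum_le hd (fun j => h0 j s) (fun j => h1 j s)
              _ = Real.exp (-ε) := by rw [← Real.exp_add, hK]; congr 1; ring
        _ = Real.exp (-ε) := by simp
    have hle' : Real.exp ε * ∫ s, cubeMean (fun x => φ x s) ∂Q ≤ 1 := by
      calc _ ≤ Real.exp ε * Real.exp (-ε) := by gcongr
        _ = 1 := by rw [← Real.exp_add]; simp
    calc _ ≤ Real.sqrt d * (K - 1 + (1 + δ * Real.sqrt d)) := by gcongr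
      _ = (ε + 1 / 2) * Real.sqrt d + δ * d := by rw [hK]; linear_combination δ * hss
      _ ≤ 2 * ε * Real.sqrt d + 2 * δ * d := by
        have : 0 ≤ δ * d := by positivity
        nlinarith

end CubeIndist

/-! ### Splitting an execution at an intermediate state. -/

namespace OnlineAlgorithm

variable {X S O : Type*} [MeasurableSpace X] [MeasurableSpace S] [MeasurableSpace O]

theorem run_append (M : OnlineAlgorithm X S O) (k : ℕ) (l l' : List X) :
    M.run k (l ++ l') = M.run (k + l.length) l' ∘ₖ M.run k l := by
  induction l generalizing k with
  | nil => simp [run]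
  | cons a l ih =>
    simp only [List.cons_append, run, List.length_cons]
    rw [ih, Kernel.comp_assoc]
    congr 2
    ring

theorem stateLaw_append (M : OnlineAlgorithm X S O) {l : List X} (hl : l ≠ []) (l' : List X) :
    M.stateLaw (l ++ l') = (M.stateLaw l).bind (M.run l.length l') := by
  cases l with
  | nil => exact absurd rfl hl
  | cons a l =>
    simp only [List.cons_append, stateLaw, List.length_cons]
    rw [run_append, Measure.comp_assoc, add_comm]

theorem outputLaw_append (M : OnlineAlgorithm X S O) {l : List X} (hl : l ≠ []) (l' : List X) :
    M.outputLaw (l ++ l') = (M.stateLaw l).bind (M.output ∘ₖ M.run l.length l') := by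
  rw [outputLaw, stateLaw_append M hl, Measure.comp_assoc]

theorem outputLaw_append_real (M : OnlineAlgorithm X S O) {l : List X} (hl : l ≠ []) (l' : List X)
    {T : Set O} (hT : MeasurableSet T) :
    (M.outputLaw (l ++ l')).real T =
      ∫ s, ((M.output ∘ₖ M.run l.length l') s).real T ∂M.stateLaw l := by
  rw [outputLaw_append M hl, measureReal_def, Measure.bind_apply hT (Kernel.aemeasurable _)]
  exact (integral_toReal (Kernel.measurable_coe _ hT).aemeasurable
    (Filter.Eventually.of_forall fun s => measure_lt_top _ _)).symm

theorem viewLaw_prod_univ (M : OnlineAlgorithm X S O) {t : ℕ} {x : List X}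
    (h : x.take t ≠ []) {T : Set S} (hT : MeasurableSet T) :
    M.viewLaw t x (T ×ˢ Set.univ) = M.stateLaw (x.take t) T := by
  have := M.isProbabilityMeasure_stateLaw h
  have e : T ×ˢ (Set.univ : Set O) = Prod.fst ⁻¹' T := by ext; simp
  rw [viewLaw, e, ← Measure.fst_apply hT, Measure.fst_compProd]

/-- Pad both streams with copies of `a` up to length n, look at the state right after the differing
element, and discard the output by testing on T × univ. -/
theorem IsPanPrivate.indist {M : OnlineAlgorithm X S O} {n : ℕ} {ε δ : ℝ}
    (h : M.IsPanPrivate n ε δ) {l : List X} (hl : l.length < n) (a b : X) :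
    Indist ε δ (M.stateLaw (l ++ [a])) (M.stateLaw (l ++ [b])) := by
  intro T hT
  obtain ⟨m, rfl⟩ : ∃ m, n = l.length + (m + 1) := ⟨n - l.length - 1, by omega⟩
  have hlen : ∀ c, (l ++ c :: List.replicate m a).length = l.length + (m + 1) := fun c => by simp
  have hof : ∀ c, List.ofFn (fun i : Fin (l.length + (m + 1)) =>
      (l ++ c :: List.replicate m a)[i.val]'(by rw [hlen]; exact i.2)) =
      l ++ c :: List.replicate m a := fun c => by
    apply List.ext_getElem
    · rw [List.length_ofFn, hlen]
    · intro i _ _; rw [List.getElem_ofFn]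
  have key := h (fun i => (l ++ a :: List.replicate m a)[i.val]'(by rw [hlen]; exact i.2))
    (fun i => (l ++ b :: List.replicate m a)[i.val]'(by rw [hlen]; exact i.2))
    ⟨⟨l.length, by omega⟩, fun j hj => by
      have hj' : j.val ≠ l.length := fun e => hj (Fin.ext e)
      simp only [List.getElem_append, List.getElem_cons]
      split_ifs <;> first | rfl | omega⟩
    (l.length + 1) (by omega) (by omega) (T ×ˢ Set.univ) (hT.prod MeasurableSet.univ)
  have htake : ∀ c, (l ++ c :: List.replicate m a).take (l.length + 1) = l ++ [c] := fun c => by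
    simp [List.take_append]
  rw [hof, hof, viewLaw_prod_univ _ (by simp [htake]) hT, viewLaw_prod_univ _ (by simp [htake]) hT,
    htake, htake] at key
  exact key

end OnlineAlgorithm

/-! ### The hard distributions. -/

section Tilt

variable {d : ℕ}

/-- The density of the product distribution on the cube whose coordinates have mean `0`, except
for the coordinate `v`, which has mean `2 * α`. -/
noncomputable def tiltWeight (α : ℝ) (v : Fin d) (x : SignCube d) : ℝ :=
  (2 ^ d : ℝ)⁻¹ * (1 + 2 * α * coordVal v x)

theorem tiltWeight_nonneg {α : ℝ} (h0 : 0 < α) (h1 : α < 1 / 2) (v : Fin d) (x : SignCube d) :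
    0 ≤ tiltWeight α v x := by
  have := neg_abs_le (coordVal v x)
  rw [abs_coordVal] at this
  exact mul_nonneg (by positivity) (by nlinarith)

theorem sum_tiltWeight_mul_coordVal (α : ℝ) (v j : Fin d) :
    ∑ x, tiltWeight α v x * coordVal j x = if v = j then 2 * α else 0 := by
  have : ∑ x, tiltWeight α v x * coordVal j x =
      cubeMean (fun x => coordVal j x + 2 * α * (coordVal v x * coordVal j x)) :=
    Finset.sum_congr rfl fun x _ => by rw [tiltWeight]; ring
  rw [this, cubeMean_add, cubeMean_const_mul, cubeMean_coordVal_mul,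
    show cubeMean (fun x => coordVal j x) = 0 from cubeMean_coordVal j]
  simp

theorem sum_tiltWeight (α : ℝ) (v : Fin d) : ∑ x, tiltWeight α v x = 1 := by
  change cubeMean (fun x => 1 + 2 * α * coordVal v x) = 1
  rw [cubeMean_add, cubeMean_const_mul, cubeMean_const,
    show cubeMean (fun x => coordVal v x) = 0 from cubeMean_coordVal v]
  simp

/-- The distribution with density `tiltWeight`. -/
noncomputable def tiltMeasure (α : ℝ) (v : Fin d) : Measure (SignCube d) :=
  ∑ x, ENNReal.ofReal (tiltWeight α v x) • Measure.dirac x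

theorem tiltMeasure_singleton (α : ℝ) (v : Fin d) (x : SignCube d) :
    tiltMeasure α v {x} = ENNReal.ofReal (tiltWeight α v x) := by
  classical
  simp [tiltMeasure, Measure.finsetSum_apply, Set.indicator_apply]

theorem isProbabilityMeasure_tiltMeasure {α : ℝ} (h0 : 0 < α) (h1 : α < 1 / 2) (v : Fin d) :
    IsProbabilityMeasure (tiltMeasure α v) := by
  constructor
  simp only [tiltMeasure, Measure.finsetSum_apply, Measure.smul_apply, measure_univ, smul_eq_mul,
    mul_one]
  rw [← ENNReal.ofReal_sum_of_nonneg fun x _ => tiltWeight_nonneg h0 h1 v x, sum_tiltWeight]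
  simp

theorem coordMean_tiltMeasure {α : ℝ} (h0 : 0 < α) (h1 : α < 1 / 2) (v j : Fin d) :
    coordMean (tiltMeasure α v) j = if v = j then 2 * α else 0 := by
  have := isProbabilityMeasure_tiltMeasure h0 h1 v
  rw [coordMean, integral_fintype (Integrable.of_finite), ← sum_tiltWeight_mul_coordVal]
  refine Finset.sum_congr rfl fun x _ => ?_
  rw [measureReal_def, tiltMeasure_singleton, ENNReal.toReal_ofReal (tiltWeight_nonneg h0 h1 v x)]
  rfl

/-- The tilt 2α exceeds the tolerance α, so every coordinate other than `v` is a wrong answer. -/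
theorem SolvesSelection.le_streamMean {n : ℕ} {α : ℝ} (h0 : 0 < α) (h1 : α < 1 / 2)
    {A : List (SignCube d) → Measure (Fin d)}
    (hA : ∀ x : Fin n → SignCube d, IsProbabilityMeasure (A (List.ofFn x)))
    (h : SolvesSelection (fun x : Fin n → SignCube d => A (List.ofFn x)) α) (v : Fin d) :
    99 / 100 ≤ streamMean (tiltWeight α v) n (fun l => (A l).real {v}) := by
  have hP := isProbabilityMeasure_tiltMeasure h0 h1 v
  have hw := tiltWeight_nonneg h0 h1 v
  have key := h (tiltMeasure α v) hP
  have hsub : {J | ∀ j, coordMean (tiltMeasure α v) j - α ≤ coordMean (tiltMeasure α v) J} ⊆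
      {v} := fun J hJ => by
    by_contra hne
    have := hJ v
    rw [coordMean_tiltMeasure h0 h1, coordMean_tiltMeasure h0 h1, if_pos rfl,
      if_neg (fun e => hne e.symm)] at this
    linarith
  have hle : (99 / 100 : ENNReal) ≤
      ENNReal.ofReal (streamMean (tiltWeight α v) n (fun l => (A l).real {v})) := by
    refine key.trans ((lintegral_mono fun x => measure_mono hsub).trans_eq ?_)
    rw [lintegral_fintype, streamMean, ENNReal.ofReal_sum_of_nonneg fun x _ =>
      mul_nonneg (Finset.prod_nonneg fun i _ => hw _) measureReal_nonneg]
    refine Finset.sum_congr rfl fun x _ => ?_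
    rw [Measure.pi_singleton, ENNReal.ofReal_mul (Finset.prod_nonneg fun i _ => hw _),
      ENNReal.ofReal_prod_of_nonneg fun i _ => hw _, ofReal_measureReal, mul_comm]
    simp [tiltMeasure_singleton]
  have h99 : (99 / 100 : ENNReal) = ENNReal.ofReal (99 / 100) := by
    rw [ENNReal.ofReal_div_of_pos (by norm_num)]; norm_num
  rw [h99] at hle
  exact (ENNReal.ofReal_le_ofReal_iff (Finset.sum_nonneg fun x _ =>
      mul_nonneg (Finset.prod_nonneg fun i _ => hw _) measureReal_nonneg)).1 hle

end Tilt

/-! ### The hybrid argument. -/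

namespace OnlineAlgorithm

variable {d : ℕ} {S : Type*} [MeasurableSpace S]

/-- The probability that the output on the stream `l` is `v`. -/
noncomputable def outputProb (M : OnlineAlgorithm (SignCube d) S (Fin d)) (v : Fin d)
    (l : List (SignCube d)) : ℝ := (M.outputLaw l).real {v}

theorem isProbabilityMeasure_outputLaw (M : OnlineAlgorithm (SignCube d) S (Fin d))
    {l : List (SignCube d)} (hl : l ≠ []) : IsProbabilityMeasure (M.outputLaw l) := by
  have := M.isProbabilityMeasure_stateLaw hl
  unfold outputLaw
  infer_instance

theorem sum_outputProb (M : OnlineAlgorithm (SignCube d) S (Fin d)) {l : List (SignCube d)}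
    (hl : l ≠ []) : ∑ v, M.outputProb v l = 1 := by
  have := M.isProbabilityMeasure_outputLaw hl
  simp [outputProb]

theorem sum_cubeMean_coordVal_mul_outputProb_le (hd : 0 < d)
    {M : OnlineAlgorithm (SignCube d) S (Fin d)} {n : ℕ} {ε δ α : ℝ} (hε : 0 < ε) (hδ : 0 ≤ δ)
    (h0 : 0 < α) (h1 : α < 1 / 2) (h : M.IsPanPrivate n ε δ) (m : ℕ) {l : List (SignCube d)}
    (hl : l.length < n) :
    ∑ v, cubeMean (fun a => coordVal v a *
        streamMean (tiltWeight α v) m (fun l' => M.outputProb v (l ++ [a] ++ l'))) ≤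
      2 * ε * Real.sqrt d + 2 * δ * d := by
  set R : SignCube d → Measure S := fun a => M.stateLaw (l ++ [a])
  have hRp : ∀ a, IsProbabilityMeasure (R a) := fun a => M.isProbabilityMeasure_stateLaw (by simp)
  set k : List (SignCube d) → Fin d → S → ℝ := fun l' v s =>
    ((M.output ∘ₖ M.run (l.length + 1) l') s).real {v}
  have hkm : ∀ l' v, Measurable (k l' v) := fun l' v =>
    (Kernel.measurable_coe _ (measurableSet_singleton v)).ennreal_toReal
  have hk0 : ∀ l' v s, 0 ≤ k l' v s := fun l' v s => measureReal_nonneg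
  have hk1 : ∀ l' v s, k l' v s ≤ 1 := fun l' v s => measureReal_le_one
  have hki : ∀ a l' v, Integrable (k l' v) (R a) := fun a l' v =>
    Integrable.of_bound (hkm l' v).aestronglyMeasurable 1 (Filter.Eventually.of_forall fun s => by
      rw [Real.norm_of_nonneg (hk0 l' v s)]; exact hk1 l' v s)
  have hw := fun v : Fin d => tiltWeight_nonneg h0 h1 v
  -- Given the state, the future is independent of `a`, so `g v` is a legitimate [0, 1]-valued test
  -- on states.
  set g : Fin d → S → ℝ := fun v s => streamMean (tiltWeight α v) m (fun l' => k l' v s)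
  have hgm : ∀ v, Measurable (g v) := fun v =>
    Finset.measurable_sum _ fun x _ => (hkm _ v).const_mul _
  have hg0 : ∀ v s, 0 ≤ g v s := fun v s =>
    Finset.sum_nonneg fun x _ => mul_nonneg (Finset.prod_nonneg fun i _ => hw v _) (hk0 _ v s)
  have hg1 : ∀ v s, g v s ≤ 1 := fun v s =>
    (streamMean_mono (hw v) fun l' _ => hk1 l' v s).trans_eq
      (streamMean_const (sum_tiltWeight α v) m 1)
  have hgi : ∀ a v, Integrable (g v) (R a) := fun a v =>
    Integrable.of_bound (hgm v).aestronglyMeasurable 1 (Filter.Eventually.of_forall fun s => by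
      rw [Real.norm_of_nonneg (hg0 v s)]; exact hg1 v s)
  refine le_of_eq_of_le ?_ (cubeMean_integral_signedSum_le hd hε hδ R
    (fun a b => h.indist hl a b) g hgm hg0 hg1)
  rw [← cubeMean_sum]
  congr 1
  funext a
  simp only [signedSum]
  rw [integral_finsetSum _ fun v _ => (hgi a v).mul_const _]
  refine Finset.sum_congr rfl fun v _ => ?_
  rw [integral_mul_const, mul_comm, integral_streamMean _ _ _ _ fun l' => hki a l' v]
  congr 2
  funext l'
  rw [outputProb, outputLaw_append_real _ (by simp) _ (measurableSet_singleton v)]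
  simp [k, R]

theorem sum_streamMean_hybrid_le (hd : 0 < d)
    {M : OnlineAlgorithm (SignCube d) S (Fin d)} {n : ℕ} {ε δ α : ℝ} (hε : 0 < ε) (hδ : 0 ≤ δ)
    (h0 : 0 < α) (h1 : α < 1 / 2) (h : M.IsPanPrivate n ε δ) (m t : ℕ) (htm : t + m = n) :
    ∑ v, streamMean (fun _ : SignCube d => (2 ^ d : ℝ)⁻¹) t (fun l =>
        streamMean (tiltWeight α v) m (fun l' => M.outputProb v (l ++ l'))) ≤
      ∑ v, streamMean (fun _ : SignCube d => (2 ^ d : ℝ)⁻¹) n (M.outputProb v) +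
        m * (2 * α * (2 * ε * Real.sqrt d + 2 * δ * d)) := by
  induction m generalizing t with
  | zero =>
    obtain rfl : t = n := by omega
    simp [streamMean_zero]
  | succ m ih =>
    have hih := ih (t + 1) (by omega)
    set u : SignCube d → ℝ := fun _ => (2 ^ d : ℝ)⁻¹ with hu
    have hu0 : ∀ a, 0 ≤ u a := fun a => by positivity
    have hu1 : ∑ a, u a = 1 := sum_uniformWeight d
    set B : ℝ := 2 * ε * Real.sqrt d + 2 * δ * d
    -- The prefix weight `u` is the same for all `v`, so the sum over `v` moves inside the prefix
    -- average and the bound applies for each fixed prefix.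
    have step : ∑ v, streamMean u t (fun l =>
          streamMean (tiltWeight α v) (m + 1) (fun l' => M.outputProb v (l ++ l'))) -
        ∑ v, streamMean u (t + 1) (fun l =>
          streamMean (tiltWeight α v) m (fun l' => M.outputProb v (l ++ l'))) ≤ 2 * α * B := by
      simp_rw [streamMean_concat u t]
      rw [← Finset.sum_sub_distrib]
      simp_rw [← streamMean_sub]
      rw [← streamMean_sum]
      refine (streamMean_mono hu0 (g := fun _ => 2 * α * B) fun l hl => ?_).trans_eq
        (streamMean_const hu1 t _)
      refine le_of_eq_of_le ?_ (mul_le_mul_of_nonneg_left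
        (sum_cubeMean_coordVal_mul_outputProb_le hd hε hδ h0 h1 h m (l := l) (by omega))
        (by positivity : 0 ≤ 2 * α))
      rw [Finset.mul_sum]
      refine Finset.sum_congr rfl fun v _ => ?_
      rw [streamMean_cons, ← Finset.sum_sub_distrib, cubeMean, Finset.mul_sum]
      refine Finset.sum_congr rfl fun a _ => ?_
      simp only [hu, tiltWeight, List.append_assoc, List.singleton_append]
      ring
    push_cast
    linarith

/-- A pan-private selection algorithm on `n` samples satisfies a counting inequality. -/
theorem IsPanPrivate.selection_le (hd : 0 < d)
    {M : OnlineAlgorithm (SignCube d) S (Fin d)} {n : ℕ} (hn : 1 ≤ n) {ε δ α : ℝ} (hε : 0 < ε)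
    (hδ : 0 ≤ δ) (h0 : 0 < α) (h1 : α < 1 / 2) (h : M.IsPanPrivate n ε δ)
    (hs : SolvesSelection (fun x : Fin n → SignCube d => M.outputLaw (List.ofFn x)) α) :
    99 / 100 * (d : ℝ) ≤ 1 + n * (2 * α * (2 * ε * Real.sqrt d + 2 * δ * d)) := by
  have hne : ∀ l : List (SignCube d), l.length = n → l ≠ [] := fun l hl e => by
    subst e; simp at hl; omega
  have hyb := sum_streamMean_hybrid_le hd hε hδ h0 h1 h n 0 (by omega)
  simp only [streamMean_zero, List.nil_append] at hyb
  have hlow : 99 / 100 * (d : ℝ) ≤ ∑ v, streamMean (tiltWeight α v) n (M.outputProb v) := by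
    calc 99 / 100 * (d : ℝ) = ∑ _v : Fin d, (99 / 100 : ℝ) := by simp [mul_comm]
      _ ≤ _ := Finset.sum_le_sum fun v _ => hs.le_streamMean h0 h1
        (fun x => M.isProbabilityMeasure_outputLaw (hne _ (by simp))) v
  have hup : ∑ v, streamMean (fun _ : SignCube d => (2 ^ d : ℝ)⁻¹) n (M.outputProb v) ≤ 1 := by
    rw [← streamMean_sum]
    refine (streamMean_mono (fun a => by positivity) (g := fun _ => (1 : ℝ)) fun l hl =>
      (M.sum_outputProb (hne l hl)).le).trans_eq (streamMean_const (sum_uniformWeight d) n 1)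
  linarith

end OnlineAlgorithm

/-! ### Absorbing δ and choosing constants. -/

theorem delta_mul_le_of_log_le {d : ℕ} (hd : 2 ≤ d) {α ε δ : ℝ} (h0 : 0 < α) (h1 : α < 1 / 2)
    (hε : 0 < ε) (hδ : 0 ≤ δ) (hδ1 : δ ≤ 1)
    (h : δ * Real.log (d / δ) ≤ 1 * (α ^ 2 * ε ^ 2 / d)) : δ * d ≤ ε * Real.sqrt d := by
  have hd' : (2 : ℝ) ≤ d := by exact_mod_cast hd
  have hs : 0 < Real.sqrt d := Real.sqrt_pos.2 (by linarith)
  have hss : Real.sqrt d * Real.sqrt d = d := Real.mul_self_sqrt (by linarith)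
  rcases hδ.eq_or_lt with rfl | hδ0
  · rw [zero_mul]; positivity
  -- If √d ≤ ε, then δ ≤ 1 suffices. Otherwise log(d/δ) ≥ 1/2 gives δd ≤ 2α²ε² ≤ ε²/2, and one
  -- factor ε is at most √d.
  rcases le_total (Real.sqrt d) ε with hc | hc
  · nlinarith
  have hlog : 1 / 2 ≤ Real.log (d / δ) := by
    have h2 : (2 : ℝ) ≤ d / δ := by rw [le_div_iff₀ hδ0]; nlinarith
    have := Real.log_le_log (by norm_num) h2
    linarith [Real.log_two_gt_d9]
  have h3 : δ * (1 / 2) ≤ 1 * (α ^ 2 * ε ^ 2 / d) := (mul_le_mul_of_nonneg_left hlog hδ).trans h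
  rw [one_mul, le_div_iff₀ (by linarith)] at h3
  have h4 : α ^ 2 ≤ 1 / 4 := by nlinarith
  have h5 : α ^ 2 * ε ^ 2 ≤ 1 / 4 * (ε * Real.sqrt d) := by
    rw [sq ε]
    gcongr
  have h6 : 0 < ε * Real.sqrt d := by positivity
  linarith

theorem mainTheorem4 :
    ∃ c : ℝ, 0 < c ∧ ∃ C : ℝ, 0 < C ∧
      ∀ (d : ℕ), 2 ≤ d → ∀ (α : ℝ), 0 < α → α < 1 / 2 →
      ∀ (ε δ : ℝ), 0 < ε → 0 ≤ δ → δ ≤ 1 →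
      ∀ (n : ℕ), 1 ≤ n →
      ∀ (S : Type*) [MeasurableSpace S] (M : OnlineAlgorithm (SignCube d) S (Fin d)),
        M.IsPanPrivate n ε δ →
        SolvesSelection (fun x : Fin n → SignCube d => M.outputLaw (List.ofFn x)) α →
        δ * Real.log (d / δ) ≤ c * (α ^ 2 * ε ^ 2 / d) →
        C * (Real.sqrt d / (α * ε)) ≤ n := by
  refine ⟨1, one_pos, 1 / 20, by norm_num, ?_⟩
  intro d hd α h0 h1 ε δ hε hδ hδ1 n hn S _ M hM hs hc
  have key := hM.selection_le (by omega) hn hε hδ h0 h1 hs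
  have hδd := delta_mul_le_of_log_le hd h0 h1 hε hδ hδ1 hc
  have hd' : (2 : ℝ) ≤ d := by exact_mod_cast hd
  have hsq : 0 < Real.sqrt d := Real.sqrt_pos.2 (by linarith)
  have hss : Real.sqrt d * Real.sqrt d = d := Real.mul_self_sqrt (by linarith)
  have hle : n * (2 * α * (2 * ε * Real.sqrt d + 2 * δ * d)) ≤
      n * (2 * α * (4 * (ε * Real.sqrt d))) := by
    gcongr
    linarith
  -- Since 1 ≤ d/2, the bound 0.99 d ≤ 1 + 8nαε√d leaves 0.49 d ≤ 8nαε√d, and 8/0.49 < 20.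
  have h2 : Real.sqrt d * Real.sqrt d ≤ 20 * (n * (α * ε)) * Real.sqrt d := by
    rw [hss]; linarith
  have h3 := le_of_mul_le_mul_right h2 hsq
  rw [← mul_div_assoc, div_le_iff₀ (by positivity)]
  linarith
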